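/- Let $G=(V,E)$ be a finite simple graph with edge weights $w:E\to[0,1]$. A forest cover of $G$ is an acyclic subgraph $F$ whose vertex set is a vertex cover of $G$; its weighted index is $wi(F)=\sum_T|T|-\sum_{e\in E(F)}(1-w_e)$, where $T$ ranges over the trees (connected components) of $F$ and $|T|$ is the number of vertices of $T$. For $S\subseteq V$ let $E(S)$ be the set of edges with both endpoints in $S$. The LP relaxation of the forest cover problem is: minimize $\sum_{i\in V}x_i-\sum_{e\in E}y_e(1-w_e)$ subject to $x_i+x_j\ge 1$ for all $(i,j)\in E$; $x_i\ge y_e$ for every $e\in E$ and each endpoint $i$ of $e$; $\sum_{i\in S}x_i-\sum_{e\in E(S)}y_e\ge 1$ for all $S\subseteq V$ with $E(S)\ne\emptyset$; and $x_i,y_e\in[0,1]$. Consider the following algorithm. Take an optimal solution $(x^*,y^*)$ of the LP relaxation, and let $G^*$ be the subgraph of $G$ with vertex set $\{i: x^*_i>0\}$ and edge set $\{e: y^*_e>0\}$. On each connected component $C$ of $G^*$ having at least one edge, build a spanning tree $M_C$ by Kruskal's algorithm (with respect to $w$, ties broken arbitrarily), and delete from $M_C$ all vertices $i$ of degree one in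 $M_C$ with $x^*_i<\frac12$, together with their incident edges; let $T_C$ be what remains. Output $APX$, the union of all the $T_C$ and of all isolated vertices $i$ of $G^*$ with $x^*_i\ge\frac12$. Then a forest cover of minimum weighted index exists, the algorithm has an output, and for every forest cover $OPT_{FC}$ of minimum weighted index and every output $APX$ of the algorithm (for any choice of the optimal LP solution and of the tie-breaking), $APX$ is a forest cover of $G$ and $$wi(OPT_{FC})\ \ge\ \tfrac12\, wi(APX).$$ -/

import Mathlib

/-!
Forest covers of finite weighted graphs, the linear programming relaxation, and its rounding.
Edge-indexed data (weights `w`, variables `y`) are functions on `Sym2 V`; only their values on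
edges of the graph matter.
-/

namespace ForestCover

noncomputable section

variable {V : Type*} {G : SimpleGraph V}

/-! ### The problem -/

/-- A forest cover: an acyclic subgraph whose vertices form a vertex cover of `G`. -/
def IsForestCover (F : G.Subgraph) : Prop :=
  F.coe.IsAcyclic ∧ G.IsVertexCover F.verts

open Classical in
/-- The weighted index `∑ₜ |T| - ∑ₑ (1 - wₑ)`, where `T` ranges over the connected components
of `F` and `e` over the edges of `F`. -/
def wi [Fintype V] (w : Sym2 V → ℝ) (F : G.Subgraph) : ℝ :=
  ∑ T : F.coe.ConnectedComponent, (T.supp.ncard : ℝ) - ∑ e ∈ F.edgeSet.toFinset, (1 - w e)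

/-- A forest cover of minimum weighted index. -/
def IsOptimalForestCover [Fintype V] (w : Sym2 V → ℝ) (F : G.Subgraph) : Prop :=
  IsForestCover F ∧ ∀ F' : G.Subgraph, IsForestCover F' → wi w F ≤ wi w F'

/-! ### The LP relaxation -/

open Classical in
/-- `E(S)`: the edges of `G` with both endpoints in `S`. -/
def edgesWithin [Fintype V] (G : SimpleGraph V) (S : Finset V) : Finset (Sym2 V) :=
  G.edgeFinset.filter fun e => ∀ v ∈ e, v ∈ S

/-- Feasible points of the relaxation, in which `0 ≤ x, y ≤ 1` replaces integrality. -/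
structure IsFeasible [Fintype V] (G : SimpleGraph V) (x : V → ℝ) (y : Sym2 V → ℝ) : Prop where
  cover : ∀ i j, G.Adj i j → 1 ≤ x i + x j
  le_vertex : ∀ e ∈ G.edgeSet, ∀ i ∈ e, y e ≤ x i
  subset : ∀ S : Finset V, (edgesWithin G S).Nonempty →
    1 ≤ ∑ i ∈ S, x i - ∑ e ∈ edgesWithin G S, y e
  vertex_mem : ∀ i, x i ∈ Set.Icc (0 : ℝ) 1
  edge_mem : ∀ e ∈ G.edgeSet, y e ∈ Set.Icc (0 : ℝ) 1

open Classical in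
/-- The objective function of the LP. -/
def objective [Fintype V] (G : SimpleGraph V) (w : Sym2 V → ℝ) (x : V → ℝ) (y : Sym2 V → ℝ) : ℝ :=
  ∑ i, x i - ∑ e ∈ G.edgeFinset, y e * (1 - w e)

/-- Optimal solutions of the LP relaxation. -/
structure IsOptimalLP [Fintype V] (G : SimpleGraph V) (w : Sym2 V → ℝ) (x : V → ℝ)
    (y : Sym2 V → ℝ) : Prop where
  feasible : IsFeasible G x y
  optimal : ∀ x' y', IsFeasible G x' y' → objective G w x y ≤ objective G w x' y'

/-- The support graph of a feasible point: vertices with `x > 0` and edges with `y > 0`. -/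
def supportGraph [Fintype V] {x : V → ℝ} {y : Sym2 V → ℝ} (h : IsFeasible G x y) : G.Subgraph where
  verts := {i | 0 < x i}
  Adj i j := G.Adj i j ∧ 0 < y s(i, j)
  adj_sub hij := hij.1
  edge_vert {i j} hij := hij.2.trans_le (h.le_vertex s(i, j) hij.1 i (Sym2.mem_mk_left i j))
  symm := ⟨fun i j hij => ⟨hij.1.symm, Sym2.eq_swap (a := i) (b := j) ▸ hij.2⟩⟩

/-! ### The rounding algorithm -/

/-- The non-empty components of `H`: those with at least one edge. (Vertices outside `H` are
edgeless components of `H.spanningCoe` and hence do not occur.) -/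
def nonemptyComponents (H : G.Subgraph) : Set G.Subgraph :=
  {C | C.edgeSet.Nonempty ∧ ∃ c : H.spanningCoe.ConnectedComponent, C = H.induce c.supp}

open Classical in
/-- The main loop of Kruskal's algorithm: go through a list of edges, starting from a set `A` of
selected edges, and select an edge when the edges selected so far do not connect its endpoints. -/
def kruskalFrom (A : Set (Sym2 V)) : List (Sym2 V) → Set (Sym2 V)
  | [] => A
  | e :: l =>
    if ∃ u v, e = s(u, v) ∧ ¬ (SimpleGraph.fromEdgeSet A).Reachable u v then
      kruskalFrom (insert e A) l
    else kruskalFrom A l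

/-- `M` is a spanning tree produced by Kruskal's algorithm on `C`: the edges of `C` are listed by
non-decreasing weight, ties being broken arbitrarily, and the loop starts from no edge. -/
def IsKruskalTree (w : Sym2 V → ℝ) (C M : G.Subgraph) : Prop :=
  ∃ l : List (Sym2 V), l.Nodup ∧ (∀ e, e ∈ l ↔ e ∈ C.edgeSet) ∧
    l.Pairwise (fun e f => w e ≤ w f) ∧ M.verts = C.verts ∧ M.edgeSet = kruskalFrom ∅ l

/-- Delete all pendant (degree one) vertices with `x < 1/2`, with their edges. -/
def prune (x : V → ℝ) (M : G.Subgraph) : G.Subgraph :=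
  M.deleteVerts {i | i ∈ M.verts ∧ (M.neighborSet i).ncard = 1 ∧ x i < 1 / 2}

/-- The isolated vertices of `H` with `x ≥ 1/2`, as a subgraph without edges. -/
def keptIsolated (x : V → ℝ) (H : G.Subgraph) : G.Subgraph where
  verts := {i | i ∈ H.verts ∧ (∀ j, ¬ H.Adj i j) ∧ 1 / 2 ≤ x i}
  Adj _ _ := False
  adj_sub := False.elim
  edge_vert := False.elim
  symm := ⟨fun _ _ => id⟩

/-- `F` is an output of the LP-rounding algorithm on `(G, w)`. -/
def IsLPRounding [Fintype V] (w : Sym2 V → ℝ) (F : G.Subgraph) : Prop :=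
  ∃ (x : V → ℝ) (y : Sym2 V → ℝ) (h : IsOptimalLP G w x y) (M : G.Subgraph → G.Subgraph),
    (∀ C ∈ nonemptyComponents (supportGraph h.feasible), IsKruskalTree w C (M C)) ∧
    F = keptIsolated x (supportGraph h.feasible) ⊔
      ⨆ C ∈ nonemptyComponents (supportGraph h.feasible), prune x (M C)

end

end ForestCover

namespace ForestCover

/-! ### Depth functions on forests -/

/-! The component sizes of a forest cover `F` add up to its number of vertices, so `wi w F` is the
LP objective at the indicator vectors of `F`. These are feasible, since a nonempty vertex set of a
forest spans fewer edges than it has vertices. Hence the LP optimum is at most `wi w OPT`, and it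
remains to show that `wi w APX` is at most twice the LP value.

Let `M` be the union of the Kruskal trees, seen as a forest on all of `V`, and `R` the set of
vertices absent from the output. All of them have `x < 1/2` and degree at most one in `M`. For a
threshold `t`, let `N` consist of the edges of `M` with `t ≤ 1 - w e`. Three estimates combine at
each `t`: (a) By Kruskal, every support edge with `t ≤ 1 - w e` lies inside one component of `N`.
Summing the subset constraints over components bounds `∑ x - ∑ y` of the layer below by 1 for each
component with an edge and by `x q` for each isolated vertex `q` (`sum_isTop_le`). (b) The number of
vertices minus edges left after deleting `R` is at most the number of components of `N` minus the
number of isolated vertices in `R` (`card_compl_add_card_isolated_le`). (c) That difference is at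
most twice the lower bound in (a) (`card_isTop_le`). Only isolated vertices outside `R` with `x <
1/2` are in deficit. Each has degree at least two in `M`, hence a child, whose component in `N` pays
for it by the cover constraint. The resulting inequality holds for every `t`, and layer-cake
summation over `t` turns it into the weighted bound (`card_sub_sum_le`).

Depth functions root the forests: the tops of `N` represent its components, and distinct vertices
have distinct children. -/

/-- `d` is a depth function of the forest `M`: adjacent vertices have different depths, and every
vertex has at most one neighbour (its parent) of smaller depth. -/
structure IsDepth {V : Type*} (M : SimpleGraph V) (d : V → ℕ) : Prop where
  ne_of_adj : ∀ ⦃u v⦄, M.Adj u v → d u ≠ d v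
  parent_unique : ∀ ⦃u u' v⦄, M.Adj u v → M.Adj u' v → d u < d v → d u' < d v → u = u'

/-- Distance from a chosen root in each component works: in a forest, the only neighbour of `v`
closer to the root is the penultimate vertex of the path from the root to `v`. -/
theorem exists_isDepth {V : Type*} {M : SimpleGraph V} (hM : M.IsAcyclic) :
    ∃ d : V → ℕ, IsDepth M d := by
  classical
  have hr : ∀ v, M.Reachable (M.connectedComponentMk v).out v := fun v =>
    SimpleGraph.ConnectedComponent.exact (Quot.out_eq _)
  have hc : ∀ u v, M.Adj u v → M.connectedComponentMk u = M.connectedComponentMk v := fun u v h =>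
    SimpleGraph.ConnectedComponent.sound h.reachable
  refine ⟨fun v => M.dist (M.connectedComponentMk v).out v, ?_, ?_⟩
  · intro u v h
    simp only [← hc u v h]
    exact hM.dist_ne_of_adj h (hr u)
  · intro u u' v h h' hd hd'
    simp only [hc u v h, hc u' v h'] at hd hd'
    set r := (M.connectedComponentMk v).out
    obtain ⟨q, hq, hq'⟩ := (hr v).exists_path_of_dist
    have key : ∀ a, M.Adj a v → M.dist r a < M.dist r v → a = q.penultimate := by
      intro a ha hda
      refine hM.eq_penultimate_of_adj_end hq ha.symm ?_
      obtain ⟨p, hp, hp'⟩ := ((hr v).trans ha.symm.reachable).exists_path_of_dist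
      -- A shortest path to `a` is too short to pass through the deeper vertex `v`.
      have hv : v ∉ p.support := by
        intro hv
        have h1 := SimpleGraph.dist_le (p.takeUntil v hv)
        have h2 := p.length_takeUntil_le_length hv
        change p.length = M.dist r a at hp'
        change M.dist r v ≤ _ at h1
        omega
      exact hM.mem_support_of_ne_mem_support_of_adj_of_isPath hq hp ha.symm hv
    rw [key u h hd, key u' h' hd']

theorem IsDepth.mono {V : Type*} {M N : SimpleGraph V} {d : V → ℕ} (h : IsDepth M d) (hN : N ≤ M) :
    IsDepth N d :=
  ⟨fun _ _ huv => h.ne_of_adj (hN huv), fun _ _ _ h1 h2 => h.parent_unique (hN h1) (hN h2)⟩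

/-- A vertex without a parent. -/
def IsTop {V : Type*} (N : SimpleGraph V) (d : V → ℕ) (v : V) : Prop :=
  ∀ u, N.Adj u v → ¬ d u < d v

/-- From a top, every vertex of its component is reached by a chain of increasing depth. A nonempty
chain would give its last vertex a parent, so each component has at most one top. -/
theorem IsDepth.eq_of_isTop {V : Type*} {N : SimpleGraph V} {d : V → ℕ} (h : IsDepth N d) {j j' : V}
    (hj : IsTop N d j) (hj' : IsTop N d j') (hr : N.Reachable j j') : j = j' := by
  have key : ∀ v, N.Reachable j v → Relation.ReflTransGen (fun a b => N.Adj a b ∧ d a < d b) j v := by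
    intro v hv
    rw [SimpleGraph.reachable_iff_reflTransGen] at hv
    induction hv with
    | refl => exact .refl
    | @tail v u _ hvu ih =>
      rcases lt_or_gt_of_ne (h.ne_of_adj hvu) with hlt | hgt
      · exact ih.tail ⟨hvu, hlt⟩
      -- A step upwards goes to the unique parent, so it cancels the last step of the chain; it
      -- cannot leave `j`, which has no parent.
      · cases ih with
        | refl => exact absurd hgt (hj _ hvu.symm)
        | @tail b _ hb hbv => rwa [h.parent_unique hvu.symm hbv.1 hgt hbv.2]
  cases key j' hr with
  | refl => rfl
  | tail _ hb => exact absurd hb.2 (hj' _ hb.1)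

/-- A forest has at least as many edges as vertices with a parent. -/
theorem IsDepth.card_filter_not_isTop_le {V : Type*} [Fintype V] [DecidableEq V]
    {N : SimpleGraph V} [DecidableRel N.Adj] {d : V → ℕ} [DecidablePred (IsTop N d)] :
    (Finset.univ.filter fun v => ¬ IsTop N d v).card ≤ N.edgeFinset.card := by
  have : ∀ v, ∃ u, ¬ IsTop N d v → N.Adj u v ∧ d u < d v := by
    intro v
    by_cases hv : IsTop N d v
    · exact ⟨v, fun h => absurd hv h⟩
    · unfold IsTop at hv
      push Not at hv
      obtain ⟨u, hu⟩ := hv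
      exact ⟨u, fun _ => hu⟩
  choose p hp using this
  refine Finset.card_le_card_of_injOn (fun v => s(p v, v)) ?_ ?_
  · intro v hv
    simp only [Finset.coe_filter, Finset.mem_univ, true_and, Set.mem_ofPred_eq] at hv
    simpa using (hp v hv).1
  · intro v hv v' hv' he
    simp only [Finset.coe_filter, Finset.mem_univ, true_and, Set.mem_ofPred_eq] at hv hv'
    have h1 := (hp v hv).2
    have h2 := (hp v' hv').2
    simp only [Sym2.eq_iff] at he
    rcases he with ⟨_, he⟩ | ⟨he, he'⟩
    · exact he
    · rw [he, he'] at h1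
      omega

/-- A non-empty vertex set of a forest spans fewer edges than it has vertices. -/
theorem IsDepth.card_edges_lt {V : Type*} {M : SimpleGraph V} {d : V → ℕ} (hd : IsDepth M d) {S : Finset V}
    (hS : S.Nonempty) {E : Finset (Sym2 V)} (hE : ∀ e ∈ E, e ∈ M.edgeSet ∧ ∀ v ∈ e, v ∈ S) :
    E.card < S.card := by
  classical
  -- Each edge is charged to its deeper endpoint, and the shallowest vertex `r` is never charged.
  obtain ⟨r, hrS, hr⟩ := S.exists_min_image d hS
  have : ∀ e, ∃ v, e ∈ E → ∃ u, e = s(u, v) ∧ d u < d v := by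
    intro e
    induction e with
    | h a b =>
      by_cases h : s(a, b) ∈ E
      · rcases lt_or_gt_of_ne (hd.ne_of_adj (hE _ h).1) with hlt | hgt
        · exact ⟨b, fun _ => ⟨a, rfl, hlt⟩⟩
        · exact ⟨a, fun _ => ⟨b, Sym2.eq_swap, hgt⟩⟩
      · exact ⟨a, fun h' => absurd h' h⟩
  choose c hc using this
  refine lt_of_le_of_lt (b := (S.erase r).card) ?_ (Finset.card_erase_lt_of_mem hrS)
  refine Finset.card_le_card_of_injOn c ?_ ?_
  · intro e he
    obtain ⟨u, hu, hlt⟩ := hc e he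
    have hm := (hE e he).2
    rw [hu] at hm
    have h1 := hm u (by simp)
    have h2 := hm (c e) (by simp)
    refine Finset.mem_coe.2 (Finset.mem_erase.2 ⟨?_, h2⟩)
    intro h
    have := hr u h1
    rw [← h] at this
    omega
  · intro e he e' he' hcc
    obtain ⟨u, hu, hlt⟩ := hc e he
    obtain ⟨u', hu', hlt'⟩ := hc e' he'
    have h1 := (hE e he).1
    have h2 := (hE e' he').1
    rw [hu] at h1
    rw [hu', ← hcc] at h2
    rw [← hcc] at hlt' hu'
    have huu : u = u' := hd.parent_unique h1 h2 hlt hlt'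
    rw [hu, hu', huu]

/-! ### Layer-cake summation -/

/-- A linear functional that is at most `B` on all superlevel sets of `c ∈ [0, b]` is at most
`b * B` on `c`. -/
theorem sum_mul_le_of_superlevel {ι : Type*} [DecidableEq ι] (E : Finset ι) (a : ι → ℝ) (B : ℝ)
    (hB : 0 ≤ B) (c : ι → ℝ) (b : ℝ) (hc0 : ∀ e ∈ E, 0 ≤ c e) (hcb : ∀ e ∈ E, c e ≤ b) (hb : 0 ≤ b)
    (h : ∀ t : ℝ, 0 < t → ∑ e ∈ E with t ≤ c e, a e ≤ B) :
    ∑ e ∈ E, a e * c e ≤ b * B := by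
  induction hn : (E.filter fun e => 0 < c e).card using Nat.strong_induction_on generalizing c b with
  | _ n ih =>
  by_cases hne : (E.filter fun e => 0 < c e).Nonempty
  · obtain ⟨m, hm, hmin⟩ := Finset.exists_min_image _ c hne
    rw [Finset.mem_filter] at hm
    have hmin' : ∀ e ∈ E, 0 < c e → c m ≤ c e := fun e he hce => hmin e (by simp [he, hce])
    -- Peel off the bottom layer, of height `c m`, the least positive value. The support loses `m`,
    -- and the superlevel sets of `c'` are superlevel sets of `c`.
    let c' : ι → ℝ := fun e => if c m ≤ c e then c e - c m else 0
    have hc'0 : ∀ e ∈ E, 0 ≤ c' e := by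
      intro e he
      simp only [c']
      split_ifs <;> linarith
    have := ih _ ?_ c' (b - c m) hc'0 ?_ ?_ ?_ rfl
    · have hsplit : ∑ e ∈ E, a e * c e
          = ∑ e ∈ E, a e * c' e + c m * ∑ e ∈ E with c m ≤ c e, a e := by
        rw [Finset.sum_filter, Finset.mul_sum, ← Finset.sum_add_distrib]
        refine Finset.sum_congr rfl fun e he => ?_
        by_cases hce : c m ≤ c e
        · simp only [c', hce, if_true]
          ring
        · have : c e = 0 := le_antisymm (not_lt.1 fun h => hce (hmin' e he h)) (hc0 e he)
          simp [c', hm.2.not_ge, this]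
      have h2 := mul_le_mul_of_nonneg_left (h (c m) hm.2) hm.2.le
      rw [hsplit]
      linarith
    · rw [← hn]
      refine Finset.card_lt_card ⟨?_, ?_⟩
      · intro e he
        rw [Finset.mem_filter] at he ⊢
        refine ⟨he.1, ?_⟩
        have h2 := he.2
        simp only [c'] at h2
        split_ifs at h2 with h3
        · linarith [hm.2]
        · exact absurd h2 (lt_irrefl 0)
      · intro hsub
        have := hsub (Finset.mem_filter.2 hm)
        simp [c'] at this
    · intro e he
      have := hcb e he
      have := hcb m hm.1
      simp only [c']
      split_ifs <;> linarith
    · linarith [hcb m hm.1]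
    · intro t ht
      have : (E.filter fun e => t ≤ c' e) = E.filter fun e => t + c m ≤ c e := by
        refine Finset.filter_congr fun e he => ?_
        simp only [c']
        split_ifs with h3
        · exact le_sub_iff_add_le
        · constructor
          · intro h4
            linarith
          · intro h4
            linarith
      rw [this]
      exact h _ (by linarith [hm.2])
  · rw [Finset.not_nonempty_iff_eq_empty, Finset.filter_eq_empty_iff] at hne
    rw [Finset.sum_eq_zero]
    · positivity
    · intro e he
      rw [le_antisymm (not_lt.1 (hne he)) (hc0 e he), mul_zero]


/-! ### Rounding a spanning forest, one layer at a time -/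

section Layer

variable {V : Type*} [Fintype V] {G : SimpleGraph V} {x : V → ℝ} {y : Sym2 V → ℝ}

open Classical in
/-- The LP constraints of the components of `N` bound the LP value of one layer from below. -/
theorem IsFeasible.sum_isTop_le (h : IsFeasible G x y) {N : SimpleGraph V} (hN : N ≤ G)
    {d : V → ℕ} (hd : IsDepth N d) {E : Finset (Sym2 V)} (hE : E ⊆ G.edgeFinset)
    (hconn : ∀ u v, s(u, v) ∈ E → 0 < y s(u, v) → N.Reachable u v) :
    ∑ q with IsTop N d q, (if ∃ u, N.Adj u q then 1 else x q) ≤ ∑ i, x i - ∑ e ∈ E, y e := by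
  let S : N.ConnectedComponent → Finset V := fun K =>
    Finset.univ.filter fun i => N.connectedComponentMk i = K
  let F : N.ConnectedComponent → ℝ := fun K => ∑ i ∈ S K, x i - ∑ e ∈ edgesWithin G (S K), y e
  have hF0 : ∀ K, 0 ≤ F K := by
    intro K
    by_cases hne : (edgesWithin G (S K)).Nonempty
    · exact zero_le_one.trans (h.subset _ hne)
    · rw [Finset.not_nonempty_iff_eq_empty] at hne
      simp only [F, hne, Finset.sum_empty, sub_zero]
      exact Finset.sum_nonneg fun i _ => (h.vertex_mem i).1
  have hFq : ∀ q, (if ∃ u, N.Adj u q then 1 else x q) ≤ F (N.connectedComponentMk q) := by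
    intro q
    by_cases hne : (edgesWithin G (S (N.connectedComponentMk q))).Nonempty
    · refine le_trans ?_ (h.subset _ hne)
      split_ifs
      · exact le_rfl
      · exact (h.vertex_mem q).2
    · have hq : ¬ ∃ u, N.Adj u q := by
        rintro ⟨u, hu⟩
        refine hne ⟨s(u, q), ?_⟩
        simp only [edgesWithin, Finset.mem_filter, SimpleGraph.mem_edgeFinset,
          SimpleGraph.mem_edgeSet, S, Finset.mem_univ, true_and]
        refine ⟨hN hu, fun v hv => ?_⟩
        rcases Sym2.mem_iff.1 hv with rfl | rfl
        · exact SimpleGraph.ConnectedComponent.sound hu.reachable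
        · rfl
      rw [if_neg hq]
      rw [Finset.not_nonempty_iff_eq_empty] at hne
      simp only [F, hne, Finset.sum_empty, sub_zero]
      exact Finset.single_le_sum (f := x) (fun i _ => (h.vertex_mem i).1) (by simp [S])
  have hinj : Set.InjOn N.connectedComponentMk
      (Finset.univ.filter fun q => IsTop N d q : Finset V) := by
    intro q hq q' hq' he
    simp only [Finset.coe_filter, Finset.mem_univ, true_and, Set.mem_ofPred_eq] at hq hq'
    exact hd.eq_of_isTop hq hq' (SimpleGraph.ConnectedComponent.exact he)
  have hx : ∑ K, ∑ i ∈ S K, x i = ∑ i, x i := Finset.sum_fiberwise _ _ _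
  have hy : ∑ e ∈ E, y e ≤ ∑ K, ∑ e ∈ edgesWithin G (S K), y e := by
    have hyG : ∀ e ∈ G.edgeFinset, 0 ≤ y e := fun e he =>
      (h.edge_mem e (SimpleGraph.mem_edgeFinset.1 he)).1
    have hsw : ∑ K, ∑ e ∈ edgesWithin G (S K), y e
        = ∑ e ∈ G.edgeFinset, ∑ K, if ∀ v ∈ e, v ∈ S K then y e else 0 := by
      rw [Finset.sum_comm]
      refine Finset.sum_congr rfl fun K _ => ?_
      rw [edgesWithin, Finset.sum_filter]
    rw [hsw]
    refine le_trans (Finset.sum_le_sum fun e he => ?_)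
      (Finset.sum_le_sum_of_subset_of_nonneg hE fun e he _ => ?_)
    -- Edges with `y e = 0` may join different components but contribute nothing; the others lie
    -- inside one component by `hconn`.
    · rcases (hyG e (hE he)).eq_or_lt with h0 | hpos
      · rw [← h0]
        simp
      · induction e with
        | h u v =>
        refine le_trans (le_of_eq ?_) (Finset.single_le_sum (fun K _ => ?_)
          (Finset.mem_univ (N.connectedComponentMk u)))
        · rw [if_pos]
          intro z hz
          simp only [S, Finset.mem_filter, Finset.mem_univ, true_and]
          rcases Sym2.mem_iff.1 hz with rfl | rfl
          · rfl
          · exact SimpleGraph.ConnectedComponent.sound (hconn _ _ he hpos).symm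
        · split_ifs
          exacts [hpos.le, le_rfl]
    · refine Finset.sum_nonneg fun K _ => ?_
      split_ifs
      exacts [hyG e he, le_rfl]
  calc ∑ q with IsTop N d q, (if ∃ u, N.Adj u q then 1 else x q)
      ≤ ∑ q with IsTop N d q, F (N.connectedComponentMk q) := Finset.sum_le_sum fun q _ => hFq q
    _ = ∑ K ∈ (Finset.univ.filter fun q => IsTop N d q).image N.connectedComponentMk, F K :=
        (Finset.sum_image hinj).symm
    _ ≤ ∑ K, F K :=
        Finset.sum_le_sum_of_subset_of_nonneg (Finset.subset_univ _) fun K _ _ => hF0 K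
    _ = ∑ i, x i - ∑ K, ∑ e ∈ edgesWithin G (S K), y e := by
        rw [← hx, ← Finset.sum_sub_distrib]
    _ ≤ _ := by linarith

open Classical in
/-- Deleting a set `R` of vertices of degree at most one from the forest `N` leaves at most one
component per top, and none for the isolated vertices in `R`. -/
theorem card_compl_add_card_isolated_le {N : SimpleGraph V} {d : V → ℕ}
    {R : Finset V} (hR : ∀ i ∈ R, ∀ u v, N.Adj i u → N.Adj i v → u = v) :
    (Finset.univ \ R).card + (R.filter fun i => ¬ ∃ u, N.Adj u i).card ≤
      (Finset.univ.filter fun q => IsTop N d q).card +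
        (N.edgeFinset.filter fun e => ∀ v ∈ e, v ∉ R).card := by
  have h1 : (Finset.univ.filter fun q => ¬ IsTop N d q).card ≤ N.edgeFinset.card := by
    convert IsDepth.card_filter_not_isTop_le (N := N) (d := d)
  have h2 : (Finset.univ.filter fun q => IsTop N d q).card +
      (Finset.univ.filter fun q => ¬ IsTop N d q).card = (Finset.univ : Finset V).card :=
    Finset.card_filter_add_card_filter_not _
  have h3 : (N.edgeFinset.filter fun e => ∀ v ∈ e, v ∉ R).card +
      (N.edgeFinset.filter fun e => ¬ ∀ v ∈ e, v ∉ R).card = N.edgeFinset.card :=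
    Finset.card_filter_add_card_filter_not _
  have h4 : (R.filter fun i => ∃ u, N.Adj u i).card +
      (R.filter fun i => ¬ ∃ u, N.Adj u i).card = R.card :=
    Finset.card_filter_add_card_filter_not _
  -- Charge each deleted edge to an endpoint in `R`; degree at most one makes the charging
  -- injective.
  have h5 : (N.edgeFinset.filter fun e => ¬ ∀ v ∈ e, v ∉ R).card ≤
      (R.filter fun i => ∃ u, N.Adj u i).card := by
    have : ∀ e : Sym2 V, ∃ v, (¬ ∀ v ∈ e, v ∉ R) → v ∈ e ∧ v ∈ R := by
      intro e
      by_cases he : ∀ v ∈ e, v ∉ R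
      · induction e with
        | h a b => exact ⟨a, fun h' => absurd he h'⟩
      · have he' := he
        push Not at he'
        obtain ⟨v, hv⟩ := he'
        exact ⟨v, fun _ => hv⟩
    choose f hf using this
    have hadj : ∀ e ∈ N.edgeFinset.filter fun e => ¬ ∀ v ∈ e, v ∉ R,
        f e ∈ R ∧ ∃ u, e = s(f e, u) ∧ N.Adj (f e) u := by
      intro e he
      rw [Finset.mem_filter] at he
      obtain ⟨hm, hr⟩ := hf e he.2
      obtain ⟨u, hu⟩ := Sym2.mem_iff_exists.1 hm
      refine ⟨hr, u, hu, ?_⟩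
      have h6 := SimpleGraph.mem_edgeFinset.1 he.1
      rw [hu] at h6
      exact h6
    refine Finset.card_le_card_of_injOn f ?_ ?_
    · intro e he
      obtain ⟨hr, u, _, hu⟩ := hadj e he
      exact Finset.mem_coe.2 (Finset.mem_filter.2 ⟨hr, u, hu.symm⟩)
    · intro e he e' he' hee
      obtain ⟨hr, u, h6, hu⟩ := hadj e he
      obtain ⟨_, u', h6', hu'⟩ := hadj e' he'
      rw [← hee] at hu' h6'
      have huu : u = u' := hR _ hr _ _ hu hu'
      rw [h6, h6', huu]
  have h6 := Finset.card_sdiff_add_card_eq_card (Finset.subset_univ R)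
  omega

open Classical in
/-- Every kept isolated vertex of `N` with `x < 1/2` has a child in `M`, which pays for it. -/
theorem card_isTop_le {M N : SimpleGraph V} (hN : N ≤ M) {d : V → ℕ} (hd : IsDepth M d)
    (hcov : ∀ i j, M.Adj i j → 1 ≤ x i + x j) (hx0 : ∀ i, 0 ≤ x i) {R : Finset V}
    (hlow : ∀ i ∈ R, x i < 1 / 2)
    (hdeg : ∀ i ∉ R, x i < 1 / 2 → ∃ u v, u ≠ v ∧ M.Adj u i ∧ M.Adj v i) :
    ((Finset.univ.filter fun q => IsTop N d q).card : ℝ) ≤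
      2 * ∑ q with IsTop N d q, (if ∃ u, N.Adj u q then 1 else x q) +
        (R.filter fun i => ¬ ∃ u, N.Adj u i).card := by
  set Q := Finset.univ.filter fun q => IsTop N d q with hQ
  -- The deficit of a top `q`; the claim is that the deficits sum to at most zero. They can be
  -- positive only on `L`.
  let h : V → ℝ := fun q => 1 - 2 * (if ∃ u, N.Adj u q then 1 else x q) -
    (if q ∈ R ∧ ¬ ∃ u, N.Adj u q then 1 else 0)
  let L := Q.filter fun q => q ∉ R ∧ x q < 1 / 2 ∧ ¬ ∃ u, N.Adj u q
  have hnonpos : ∀ q ∈ Q \ L, h q ≤ 0 := by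
    intro q hq
    rw [Finset.mem_sdiff] at hq
    have hq2 : ¬ (q ∉ R ∧ x q < 1 / 2 ∧ ¬ ∃ u, N.Adj u q) := fun hh =>
      hq.2 (Finset.mem_filter.2 ⟨hq.1, hh⟩)
    have := hx0 q
    by_cases hiso : ∃ u, N.Adj u q
    · simp only [h, hiso, if_true, not_true, and_false, if_false]
      norm_num
    · by_cases hqR : q ∈ R
      · simp only [h, hiso, hqR, if_true, not_false_eq_true, and_true, if_false]
        linarith
      · have : 1 / 2 ≤ x q := not_lt.1 fun hh => hq2 ⟨hqR, hh, hiso⟩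
        simp only [h, hiso, hqR, false_and, if_false]
        linarith
  -- Of two distinct neighbours in `M`, at most one is the parent.
  have hchild : ∀ i, ∃ j, i ∈ L → M.Adj i j ∧ d i < d j := by
    intro i
    by_cases hi : i ∈ L
    · obtain ⟨u, v, huv, hu, hv⟩ := hdeg i (Finset.mem_filter.1 hi).2.1 (Finset.mem_filter.1 hi).2.2.1
      rcases lt_or_gt_of_ne (hd.ne_of_adj hu) with h1 | h1
      · rcases lt_or_gt_of_ne (hd.ne_of_adj hv) with h2 | h2
        · exact absurd (hd.parent_unique hu hv h1 h2) huv
        · exact ⟨v, fun _ => ⟨hv.symm, h2⟩⟩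
      · exact ⟨u, fun _ => ⟨hu.symm, h1⟩⟩
    · exact ⟨i, fun hh => absurd hh hi⟩
  choose f hf using hchild
  -- Since `i` is isolated in `N`, its child has lost its parent edge and is a top. The cover
  -- constraint gives the child `x > 1/2`, so it lies outside `R` and `L`, and the two deficits
  -- cancel.
  have hfL : ∀ i ∈ L, f i ∈ Q \ L ∧ h i + h (f i) ≤ 0 := by
    intro i hi
    obtain ⟨hadj, hlt⟩ := hf i hi
    obtain ⟨-, hiR, hxi, hiso⟩ := Finset.mem_filter.1 hi
    have hc := hcov _ _ hadj
    have hfR : f i ∉ R := fun hh => by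
      have := hlow _ hh
      linarith
    refine ⟨?_, ?_⟩
    · rw [Finset.mem_sdiff]
      refine ⟨?_, fun hh => ?_⟩
      · simp only [hQ, Finset.mem_filter, Finset.mem_univ, true_and]
        intro u hu hul
        have : u = i := hd.parent_unique (hN hu) hadj hul hlt
        subst this
        exact hiso ⟨_, hu.symm⟩
      · have := (Finset.mem_filter.1 hh).2.2.1
        linarith
    · simp only [h, hiso, hiR, hfR, false_and, if_false]
      split_ifs <;> linarith [hx0 i]
  have hinj : Set.InjOn f L := by
    intro i hi i' hi' hff
    obtain ⟨h1, h2⟩ := hf i hi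
    obtain ⟨h3, h4⟩ := hf i' hi'
    rw [← hff] at h3 h4
    exact hd.parent_unique h1 h3 h2 h4
  have hsub : L.image f ⊆ Q \ L := Finset.image_subset_iff.2 fun i hi => (hfL i hi).1
  have hsum : ∑ q ∈ Q, h q ≤ 0 := by
    have h1 : ∑ q ∈ Q, h q = ∑ q ∈ Q \ L, h q + ∑ q ∈ L, h q :=
      (Finset.sum_sdiff (Finset.filter_subset _ _)).symm
    have h2 : ∑ q ∈ Q \ L, h q ≤ ∑ q ∈ L.image f, h q := by
      rw [← Finset.sum_sdiff hsub]
      have : ∑ q ∈ (Q \ L) \ L.image f, h q ≤ 0 :=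
        Finset.sum_nonpos fun q hq => hnonpos q (Finset.mem_sdiff.1 hq).1
      linarith
    rw [Finset.sum_image hinj] at h2
    have h3 : ∑ i ∈ L, (h i + h (f i)) ≤ 0 := Finset.sum_nonpos fun i hi => (hfL i hi).2
    rw [Finset.sum_add_distrib] at h3
    linarith
  have hiso : ∑ q ∈ Q, (if q ∈ R ∧ ¬ ∃ u, N.Adj u q then (1 : ℝ) else 0) ≤
      (R.filter fun i => ¬ ∃ u, N.Adj u i).card := by
    rw [← Finset.sum_filter, Finset.sum_const, nsmul_eq_mul, mul_one]
    refine Nat.cast_le.2 (Finset.card_le_card fun q hq => ?_)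
    exact Finset.mem_filter.2 (Finset.mem_filter.1 hq).2
  have hexp : ∑ q ∈ Q, h q = Q.card - 2 * ∑ q ∈ Q, (if ∃ u, N.Adj u q then 1 else x q) -
      ∑ q ∈ Q, (if q ∈ R ∧ ¬ ∃ u, N.Adj u q then (1 : ℝ) else 0) := by
    simp only [h, Finset.sum_sub_distrib, Finset.mul_sum, Finset.sum_const, nsmul_eq_mul, mul_one]
  linarith

open Classical in
/-- Pruning a spanning forest `M` that is minimal with respect to `w` costs at most twice the
value of the LP solution. -/
theorem IsFeasible.card_sub_sum_le (h : IsFeasible G x y) {w : Sym2 V → ℝ}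
    (hw : ∀ e ∈ G.edgeSet, w e ∈ Set.Icc (0 : ℝ) 1) {M : SimpleGraph V} (hMG : M ≤ G)
    (hM : M.IsAcyclic)
    (hconn : ∀ u v, G.Adj u v → 0 < y s(u, v) →
      (SimpleGraph.fromEdgeSet {f | f ∈ M.edgeSet ∧ w f ≤ w s(u, v)}).Reachable u v)
    {R : Finset V} (hlow : ∀ i ∈ R, x i < 1 / 2)
    (hR : ∀ i ∈ R, ∀ u v, M.Adj i u → M.Adj i v → u = v)
    (hdeg : ∀ i ∉ R, x i < 1 / 2 → ∃ u v, u ≠ v ∧ M.Adj u i ∧ M.Adj v i) :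
    ((Finset.univ \ R).card : ℝ) - ∑ e ∈ M.edgeFinset with ∀ v ∈ e, v ∉ R, (1 - w e) ≤
      2 * objective G w x y := by
  obtain ⟨d, hd⟩ := exists_isDepth hM
  -- Twice the LP's use of an edge minus its use by the output. Weighted by `1 - w e`, the sum of
  -- `a` is the edge part of the desired inequality.
  let a : Sym2 V → ℝ := fun e => 2 * y e - if e ∈ M.edgeSet ∧ ∀ v ∈ e, v ∉ R then 1 else 0
  have hlayer : ∀ t : ℝ, ∑ e ∈ G.edgeFinset with t ≤ 1 - w e, a e ≤
      2 * ∑ i, x i - (Finset.univ \ R).card := by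
    intro t
    obtain ⟨N, hNdef⟩ : ∃ N, N = SimpleGraph.fromEdgeSet {f | f ∈ M.edgeSet ∧ t ≤ 1 - w f} :=
      ⟨_, rfl⟩
    have hN : N ≤ M := fun u v huv => by
      rw [hNdef, SimpleGraph.fromEdgeSet_adj] at huv
      exact huv.1.1
    have h1 := h.sum_isTop_le (hN.trans hMG) (hd.mono hN) (Finset.filter_subset
      (fun e => t ≤ 1 - w e) G.edgeFinset) (by
        intro u v huv hy
        rw [Finset.mem_filter, SimpleGraph.mem_edgeFinset] at huv
        rw [hNdef]
        refine (hconn u v huv.1 hy).mono (SimpleGraph.fromEdgeSet_mono ?_)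
        rintro f ⟨hf, hwf⟩
        exact ⟨hf, by linarith [huv.2]⟩)
    have h2 := card_compl_add_card_isolated_le (N := N) (d := d) (R := R)
      fun i hi u v hu hv => hR i hi u v (hN hu) (hN hv)
    have h3 := card_isTop_le hN hd (fun i j hij => h.cover i j (hMG hij))
      (fun i => (h.vertex_mem i).1) hlow hdeg
    have h4 : (N.edgeFinset.filter fun e => ∀ v ∈ e, v ∉ R) =
        (G.edgeFinset.filter fun e => t ≤ 1 - w e).filter
          fun e => e ∈ M.edgeSet ∧ ∀ v ∈ e, v ∉ R := by
      ext e
      have hMG' : e ∈ M.edgeSet → e ∈ G.edgeSet := fun he => SimpleGraph.edgeSet_mono hMG he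
      have hdiag : e ∈ M.edgeSet → e ∉ Sym2.diagSet := fun he hd' =>
        M.not_isDiag_of_mem_edgeSet he hd'
      simp only [Finset.mem_filter, SimpleGraph.mem_edgeFinset]
      rw [hNdef]
      simp only [SimpleGraph.edgeSet_fromEdgeSet, Set.mem_sdiff, Set.mem_ofPred_eq]
      tauto
    have h5 : ∑ e ∈ G.edgeFinset with t ≤ 1 - w e, a e =
        2 * ∑ e ∈ G.edgeFinset with t ≤ 1 - w e, y e -
          (N.edgeFinset.filter fun e => ∀ v ∈ e, v ∉ R).card := by
      rw [h4, Finset.sum_sub_distrib, ← Finset.mul_sum, ← Finset.sum_filter]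
      simp
    have h2' : ((Finset.univ \ R).card : ℝ) + (R.filter fun i => ¬ ∃ u, N.Adj u i).card ≤
      (Finset.univ.filter fun q => IsTop N d q).card +
        (N.edgeFinset.filter fun e => ∀ v ∈ e, v ∉ R).card := by exact_mod_cast h2
    rw [h5]
    linarith
  -- As `1 - w e ≤ 1`, the layer at 2 is empty, so the bound on the layers is nonnegative.
  have hB := hlayer 2
  rw [Finset.sum_eq_zero] at hB
  · have := sum_mul_le_of_superlevel G.edgeFinset a _ hB (fun e => 1 - w e) 1
      (fun e he => by linarith [(hw e (SimpleGraph.mem_edgeFinset.1 he)).2])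
      (fun e he => by linarith [(hw e (SimpleGraph.mem_edgeFinset.1 he)).1]) zero_le_one
      fun t _ => hlayer t
    have h6 : ∑ e ∈ G.edgeFinset, a e * (1 - w e) = 2 * ∑ e ∈ G.edgeFinset, y e * (1 - w e) -
        ∑ e ∈ M.edgeFinset with ∀ v ∈ e, v ∉ R, (1 - w e) := by
      have h7 : (M.edgeFinset.filter fun e => ∀ v ∈ e, v ∉ R) =
          G.edgeFinset.filter fun e => e ∈ M.edgeSet ∧ ∀ v ∈ e, v ∉ R := by
        ext e
        have hMG' : e ∈ M.edgeSet → e ∈ G.edgeSet := fun he => SimpleGraph.edgeSet_mono hMG he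
        simp only [Finset.mem_filter, SimpleGraph.mem_edgeFinset]
        tauto
      rw [h7, Finset.mul_sum, Finset.sum_filter, ← Finset.sum_sub_distrib]
      refine Finset.sum_congr rfl fun e _ => ?_
      simp only [a]
      split_ifs <;> ring
    rw [h6] at this
    unfold objective
    linarith
  · intro e he
    rw [Finset.mem_filter, SimpleGraph.mem_edgeFinset] at he
    linarith [(hw e he.1).1, he.2]

end Layer


/-! ### Forest covers as LP solutions -/

section Cover

variable {V : Type*} {G : SimpleGraph V}

theorem exists_isDepth_spanningCoe {F : G.Subgraph} (hF : F.coe.IsAcyclic) :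
    ∃ d : V → ℕ, IsDepth F.spanningCoe d := by
  classical
  obtain ⟨d, hd⟩ := exists_isDepth hF
  let d' : V → ℕ := fun v => if h : v ∈ F.verts then d ⟨v, h⟩ else 0
  have key : ∀ v (hv : v ∈ F.verts), d' v = d ⟨v, hv⟩ := fun v hv => dif_pos hv
  refine ⟨d', ?_, ?_⟩
  · intro u v huv
    have huv' : F.Adj u v := huv
    rw [key u huv'.fst_mem, key v huv'.snd_mem]
    exact hd.ne_of_adj (u := ⟨u, huv'.fst_mem⟩) (v := ⟨v, huv'.snd_mem⟩) huv'
  · intro u u' v huv huv2 h1 h2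
    have huv' : F.Adj u v := huv
    have huv2' : F.Adj u' v := huv2
    rw [key u huv'.fst_mem, key v huv'.snd_mem] at h1
    rw [key u' huv2'.fst_mem, key v huv'.snd_mem] at h2
    have := hd.parent_unique (u := ⟨u, huv'.fst_mem⟩) (u' := ⟨u', huv2'.fst_mem⟩)
      (v := ⟨v, huv'.snd_mem⟩) huv' huv2' h1 h2
    exact congrArg Subtype.val this

theorem exists_isForestCover : ∃ F : G.Subgraph, IsForestCover F := by
  let F : G.Subgraph :=
    { verts := Set.univ
      Adj := fun _ _ => False
      adj_sub := False.elim
      edge_vert := False.elim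
      symm := ⟨fun _ _ => id⟩ }
  refine ⟨F, ?_, by simp [F]⟩
  have : F.coe = ⊥ := by
    ext u v
    simp [F]
  rw [this]
  exact SimpleGraph.isAcyclic_bot

variable [Fintype V]

open Classical in
theorem wi_eq (w : Sym2 V → ℝ) (F : G.Subgraph) :
    wi w F = F.verts.toFinset.card - ∑ e ∈ F.edgeSet.toFinset, (1 - w e) := by
  unfold wi
  congr 1
  have h1 : ∀ T : F.coe.ConnectedComponent,
      T.supp.ncard = (Finset.univ.filter fun v => F.coe.connectedComponentMk v = T).card := by
    intro T
    rw [← Set.ncard_coe_finset]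
    congr 1
    ext v
    simp
  simp only [h1]
  have h2 := Finset.card_eq_sum_card_fiberwise (s := (Finset.univ : Finset F.verts))
    (t := (Finset.univ : Finset F.coe.ConnectedComponent))
    (f := fun v => F.coe.connectedComponentMk v) (fun v _ => by simp)
  rw [Finset.card_univ, ← Set.toFinset_card] at h2
  rw [h2]
  push_cast
  rfl

open Classical in
/-- The indicator vectors of a forest cover are feasible for the LP relaxation. -/
theorem IsForestCover.isFeasible {F : G.Subgraph} (hF : IsForestCover F) :
    IsFeasible G (fun i => if i ∈ F.verts then 1 else 0)
      (fun e => if e ∈ F.edgeSet then 1 else 0) where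
  cover i j hij := by
    rcases hF.2 hij with h | h
    · rw [if_pos h]
      split_ifs <;> norm_num
    · rw [if_pos h]
      split_ifs <;> norm_num
  le_vertex e _ i hi := by
    by_cases he : e ∈ F.edgeSet
    · rw [if_pos he, if_pos (F.mem_verts_of_mem_edge he hi)]
    · rw [if_neg he]
      split_ifs <;> norm_num
  subset S hS := by
    obtain ⟨d, hd⟩ := exists_isDepth_spanningCoe hF.1
    have hne : (S.filter fun i => i ∈ F.verts).Nonempty := by
      obtain ⟨e, he⟩ := hS
      induction e with
      | h u v =>
        simp only [edgesWithin, Finset.mem_filter, SimpleGraph.mem_edgeFinset,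
          SimpleGraph.mem_edgeSet] at he
        rcases hF.2 he.1 with h | h
        · exact ⟨u, Finset.mem_filter.2 ⟨he.2 u (by simp), h⟩⟩
        · exact ⟨v, Finset.mem_filter.2 ⟨he.2 v (by simp), h⟩⟩
    have := hd.card_edges_lt hne (E := (edgesWithin G S).filter fun e => e ∈ F.edgeSet) (by
      intro e he
      simp only [edgesWithin, Finset.mem_filter] at he
      exact ⟨by simpa using he.2, fun v hv =>
        Finset.mem_filter.2 ⟨he.1.2 v hv, F.mem_verts_of_mem_edge he.2 hv⟩⟩)
    rw [← Finset.sum_filter, ← Finset.sum_filter, Finset.sum_const, Finset.sum_const,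
      nsmul_eq_mul, nsmul_eq_mul, mul_one, mul_one, le_sub_iff_add_le]
    exact_mod_cast (by omega : 1 + ((edgesWithin G S).filter fun e => e ∈ F.edgeSet).card ≤
      (S.filter fun i => i ∈ F.verts).card)
  vertex_mem i := by
    split_ifs <;> norm_num
  edge_mem e _ := by
    split_ifs <;> norm_num

open Classical in
theorem objective_indicator (w : Sym2 V → ℝ) (F : G.Subgraph) :
    objective G w (fun i => if i ∈ F.verts then 1 else 0)
      (fun e => if e ∈ F.edgeSet then 1 else 0) = wi w F := by
  rw [wi_eq, objective]
  congr 1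
  · rw [← Finset.sum_filter, Finset.sum_const, nsmul_eq_mul, mul_one]
    congr 2
    ext i
    simp
  · simp only [ite_mul, one_mul, zero_mul]
    rw [← Finset.sum_filter]
    refine Finset.sum_congr ?_ fun _ _ => rfl
    ext e
    simp only [Finset.mem_filter, SimpleGraph.mem_edgeFinset, Set.mem_toFinset]
    exact ⟨fun h => h.2, fun h => ⟨F.edgeSet_subset h, h⟩⟩

theorem exists_isOptimalForestCover (w : Sym2 V → ℝ) :
    ∃ F : G.Subgraph, IsOptimalForestCover w F := by
  obtain ⟨F, hF, hmin⟩ := (Set.toFinite {F : G.Subgraph | IsForestCover F}).exists_minimalFor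
    (wi w) _ exists_isForestCover
  refine ⟨F, hF, fun F' hF' => ?_⟩
  rcases le_total (wi w F) (wi w F') with h | h
  · exact h
  · exact hmin hF' h

end Cover

/-! ### Kruskal's algorithm -/

section Kruskal

variable {V : Type*}

theorem subset_kruskalFrom (A : Set (Sym2 V)) (l : List (Sym2 V)) : A ⊆ kruskalFrom A l := by
  induction l generalizing A with
  | nil => exact subset_rfl
  | cons e l ih =>
    rw [kruskalFrom]
    split_ifs
    · exact (Set.subset_insert _ _).trans (ih _)
    · exact ih _

theorem kruskalFrom_subset (A : Set (Sym2 V)) (l : List (Sym2 V)) :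
    kruskalFrom A l ⊆ A ∪ {e | e ∈ l} := by
  induction l generalizing A with
  | nil => simp [kruskalFrom]
  | cons e l ih =>
    rw [kruskalFrom]
    split_ifs
    · refine (ih _).trans ?_
      rintro f ((rfl | hf) | hf)
      · exact Or.inr (by simp)
      · exact Or.inl hf
      · exact Or.inr (List.mem_cons_of_mem _ hf)
    · refine (ih _).trans ?_
      rintro f (hf | hf)
      · exact Or.inl hf
      · exact Or.inr (List.mem_cons_of_mem _ hf)

theorem isAcyclic_kruskalFrom {A : Set (Sym2 V)} (hA : (SimpleGraph.fromEdgeSet A).IsAcyclic)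
    (l : List (Sym2 V)) : (SimpleGraph.fromEdgeSet (kruskalFrom A l)).IsAcyclic := by
  induction l generalizing A with
  | nil => exact hA
  | cons e l ih =>
    rw [kruskalFrom]
    split_ifs with h
    · obtain ⟨u, v, rfl, h⟩ := h
      refine ih ?_
      have := hA.sup_edge_of_not_reachable h
      rwa [SimpleGraph.edge, ← SimpleGraph.fromEdgeSet_union, Set.union_singleton] at this
    · exact ih hA

/-- The endpoints of a processed edge are connected by selected edges that are at most as heavy. -/
theorem reachable_kruskalFrom {w : Sym2 V → ℝ} {A : Set (Sym2 V)} {l : List (Sym2 V)}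
    (hl : l.Pairwise fun e f => w e ≤ w f) (hA : ∀ f ∈ A, ∀ e ∈ l, w f ≤ w e) {u v : V}
    (huv : s(u, v) ∈ l) :
    (SimpleGraph.fromEdgeSet {f | f ∈ kruskalFrom A l ∧ w f ≤ w s(u, v)}).Reachable u v := by
  induction l generalizing A with
  | nil => simp at huv
  | cons e l ih =>
    rw [List.pairwise_cons] at hl
    rw [kruskalFrom]
    split_ifs with h
    · rcases List.mem_cons.1 huv with he | hm
      · rcases eq_or_ne u v with rfl | hne
        · exact .refl _
        refine SimpleGraph.Adj.reachable ?_
        rw [SimpleGraph.fromEdgeSet_adj]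
        exact ⟨⟨subset_kruskalFrom _ _ (he ▸ Set.mem_insert _ _), le_rfl⟩, hne⟩
      · refine ih hl.2 ?_ hm
        rintro f (rfl | hf) g hg
        · exact hl.1 g hg
        · exact hA f hf g (List.mem_cons_of_mem _ hg)
    · rcases List.mem_cons.1 huv with he | hm
      -- A rejected edge is already spanned by `A`, whose edges are no heavier by the invariant
      -- `hA`.
      · push Not at h
        refine (h u v he.symm).mono (SimpleGraph.fromEdgeSet_mono fun f hf => ?_)
        exact ⟨subset_kruskalFrom _ _ hf, hA f hf _ huv⟩
      · exact ih hl.2 (fun f hf g hg => hA f hf g (List.mem_cons_of_mem _ hg)) hm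

variable {G : SimpleGraph V} {w : Sym2 V → ℝ} {C M : G.Subgraph}

theorem IsKruskalTree.edgeSet_subset (h : IsKruskalTree w C M) : M.edgeSet ⊆ C.edgeSet := by
  obtain ⟨l, -, hl, -, -, hM⟩ := h
  rw [hM]
  intro e he
  rcases kruskalFrom_subset _ _ he with h | h
  · exact absurd h (Set.notMem_empty e)
  · exact (hl e).1 h

theorem IsKruskalTree.isAcyclic (h : IsKruskalTree w C M) : M.spanningCoe.IsAcyclic := by
  obtain ⟨l, -, -, -, -, hM⟩ := h
  rw [← SimpleGraph.fromEdgeSet_edgeSet M.spanningCoe, SimpleGraph.Subgraph.edgeSet_spanningCoe, hM]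
  refine isAcyclic_kruskalFrom ?_ l
  rw [SimpleGraph.fromEdgeSet_empty]
  exact SimpleGraph.isAcyclic_bot

theorem IsKruskalTree.reachable (h : IsKruskalTree w C M) {u v : V} (huv : C.Adj u v) :
    (SimpleGraph.fromEdgeSet {f | f ∈ M.edgeSet ∧ w f ≤ w s(u, v)}).Reachable u v := by
  obtain ⟨l, -, hl, hw, -, hM⟩ := h
  rw [hM]
  exact reachable_kruskalFrom hw (by simp) ((hl _).2 huv)

theorem exists_isKruskalTree [Finite V] (w : Sym2 V → ℝ) (C : G.Subgraph) :
    ∃ M, IsKruskalTree w C M := by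
  classical
  let l := (Set.toFinite C.edgeSet).toFinset.toList.mergeSort (fun e f => decide (w e ≤ w f))
  have hmem : ∀ e, e ∈ l ↔ e ∈ C.edgeSet := fun e => by simp [l]
  have hsub : ∀ e ∈ kruskalFrom ∅ l, e ∈ C.edgeSet := fun e he => by
    rcases kruskalFrom_subset _ _ he with h | h
    · exact absurd h (Set.notMem_empty e)
    · exact (hmem e).1 h
  let M : G.Subgraph :=
    { verts := C.verts
      Adj := fun u v => s(u, v) ∈ kruskalFrom ∅ l
      adj_sub := fun {u v} h => C.adj_sub (hsub s(u, v) h)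
      edge_vert := fun {u v} h => C.edge_vert (hsub s(u, v) h)
      symm := ⟨fun u v h => by rwa [Sym2.eq_swap]⟩ }
  refine ⟨M, l, ?_, hmem, ?_, rfl, ?_⟩
  · exact (List.mergeSort_perm _ _).nodup_iff.2 (Finset.nodup_toList _)
  · have := List.pairwise_mergeSort (le := fun e f => decide (w e ≤ w f))
      (fun a b c => by simpa using le_trans) (fun a b => by simpa using le_total _ _)
      (Set.toFinite C.edgeSet).toFinset.toList
    simpa using this
  · ext e
    induction e with
    | h u v => exact SimpleGraph.Subgraph.mem_edgeSet

end Kruskal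


/-! ### Existence of optimal LP solutions -/

section ExistsLP

variable {V : Type*} [Fintype V] {G : SimpleGraph V}

theorem isClosed_isFeasible (G : SimpleGraph V) :
    IsClosed {p : (V → ℝ) × (Sym2 V → ℝ) | IsFeasible G p.1 p.2} := by
  have : {p : (V → ℝ) × (Sym2 V → ℝ) | IsFeasible G p.1 p.2} =
      {p | ∀ i j, G.Adj i j → 1 ≤ p.1 i + p.1 j} ∩
      {p | ∀ e ∈ G.edgeSet, ∀ i ∈ e, p.2 e ≤ p.1 i} ∩
      {p | ∀ S : Finset V, (edgesWithin G S).Nonempty →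
        1 ≤ ∑ i ∈ S, p.1 i - ∑ e ∈ edgesWithin G S, p.2 e} ∩
      {p | ∀ i, p.1 i ∈ Set.Icc (0 : ℝ) 1} ∩
      {p | ∀ e ∈ G.edgeSet, p.2 e ∈ Set.Icc (0 : ℝ) 1} := by
    ext p
    exact ⟨fun h => ⟨⟨⟨⟨h.1, h.2⟩, h.3⟩, h.4⟩, h.5⟩, fun ⟨⟨⟨⟨h1, h2⟩, h3⟩, h4⟩, h5⟩ =>
      ⟨h1, h2, h3, h4, h5⟩⟩
  rw [this]
  refine (((IsClosed.inter ?_ ?_).inter ?_).inter ?_).inter ?_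
  · simp only [Set.ofPred_forall]
    exact isClosed_iInter fun i => isClosed_iInter fun j => isClosed_iInter fun _ =>
      isClosed_le (by fun_prop) (by fun_prop)
  · simp only [Set.ofPred_forall]
    exact isClosed_iInter fun e => isClosed_iInter fun _ => isClosed_iInter fun i =>
      isClosed_iInter fun _ => isClosed_le (by fun_prop) (by fun_prop)
  · simp only [Set.ofPred_forall]
    exact isClosed_iInter fun S => isClosed_iInter fun _ =>
      isClosed_le (by fun_prop) (by fun_prop)
  · simp only [Set.ofPred_forall]
    exact isClosed_iInter fun i => isClosed_Icc.preimage (by fun_prop)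
  · simp only [Set.ofPred_forall]
    exact isClosed_iInter fun e => isClosed_iInter fun _ => isClosed_Icc.preimage (by fun_prop)

theorem IsFeasible.congr_edges {x : V → ℝ} {y y' : Sym2 V → ℝ} (h : IsFeasible G x y)
    (hy : ∀ e ∈ G.edgeSet, y' e = y e) : IsFeasible G x y' where
  cover := h.cover
  le_vertex e he i hi := by
    rw [hy e he]
    exact h.le_vertex e he i hi
  subset S hS := by
    rw [Finset.sum_congr rfl fun e he => hy e (by
      simp only [edgesWithin, Finset.mem_filter, SimpleGraph.mem_edgeFinset] at he
      exact he.1)]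
    exact h.subset S hS
  vertex_mem := h.vertex_mem
  edge_mem e he := by
    rw [hy e he]
    exact h.edge_mem e he

theorem exists_isOptimalLP (G : SimpleGraph V) (w : Sym2 V → ℝ) :
    ∃ x y, IsOptimalLP G w x y := by
  classical
  -- Off the edges of `G` the values of `y` are unconstrained; setting them to zero makes the search
  -- space compact without changing the objective.
  let trunc : (Sym2 V → ℝ) → Sym2 V → ℝ := fun y e => if e ∈ G.edgeSet then y e else 0
  have htrunc : ∀ y, ∀ e ∈ G.edgeSet, trunc y e = y e := fun y e he => if_pos he
  let K : Set ((V → ℝ) × (Sym2 V → ℝ)) :=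
    (Set.univ.pi fun _ => Set.Icc 0 1) ×ˢ (Set.univ.pi fun _ => Set.Icc 0 1) ∩
      {p | IsFeasible G p.1 p.2}
  have hK : IsCompact K := ((isCompact_univ_pi fun _ => isCompact_Icc).prod
    (isCompact_univ_pi fun _ => isCompact_Icc)).inter_right (isClosed_isFeasible G)
  have hmem : ∀ x y, IsFeasible G x y → (x, trunc y) ∈ K := by
    intro x y h
    refine ⟨⟨fun i _ => h.vertex_mem i, fun e _ => ?_⟩, h.congr_edges (htrunc y)⟩
    by_cases he : e ∈ G.edgeSet
    · simp only [htrunc y e he]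
      exact h.edge_mem e he
    · simp [trunc, he]
  obtain ⟨F, hF⟩ := exists_isForestCover (G := G)
  obtain ⟨p, hp, hmin⟩ := hK.exists_isMinOn (f := fun p => objective G w p.1 p.2)
    ⟨_, hmem _ _ hF.isFeasible⟩ (by
      unfold objective
      fun_prop)
  refine ⟨p.1, p.2, hp.2, fun x y h => ?_⟩
  refine (hmin (hmem x y h)).trans_eq ?_
  change objective G w x (trunc y) = objective G w x y
  refine congrArg (∑ i, x i - ·) ?_
  exact Finset.sum_congr rfl fun e he => by rw [htrunc y e (SimpleGraph.mem_edgeFinset.1 he)]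

end ExistsLP

/-! ### The output of the algorithm -/

section Output

variable {V : Type*} {G : SimpleGraph V} {H : G.Subgraph}

theorem eq_of_mem_nonemptyComponents {C C' : G.Subgraph} (hC : C ∈ nonemptyComponents H)
    (hC' : C' ∈ nonemptyComponents H) {u : V} (hu : u ∈ C.verts) (hu' : u ∈ C'.verts) : C = C' := by
  obtain ⟨-, c, rfl⟩ := hC
  obtain ⟨-, c', rfl⟩ := hC'
  have h1 : H.spanningCoe.connectedComponentMk u = c := hu
  have h2 : H.spanningCoe.connectedComponentMk u = c' := hu'
  rw [← h1, ← h2]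

theorem adj_of_mem_nonemptyComponents {C : G.Subgraph} (hC : C ∈ nonemptyComponents H) {u v : V}
    (hu : u ∈ C.verts) (huv : H.Adj u v) : C.Adj u v := by
  obtain ⟨-, c, rfl⟩ := hC
  refine ⟨hu, ?_, huv⟩
  have h1 : H.spanningCoe.connectedComponentMk u = c := hu
  have h2 : H.spanningCoe.Adj u v := huv
  change H.spanningCoe.connectedComponentMk v = c
  rw [← h1]
  exact SimpleGraph.ConnectedComponent.sound h2.symm.reachable

theorem exists_mem_nonemptyComponents {u v : V} (huv : H.Adj u v) :
    ∃ C ∈ nonemptyComponents H, C.Adj u v := by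
  have h2 : H.spanningCoe.Adj u v := huv
  have : (H.induce (H.spanningCoe.connectedComponentMk u).supp).Adj u v :=
    ⟨rfl, SimpleGraph.ConnectedComponent.sound h2.symm.reachable, huv⟩
  exact ⟨_, ⟨⟨s(u, v), SimpleGraph.Subgraph.mem_edgeSet.2 this⟩, _, rfl⟩, this⟩

theorem exists_adj_of_reachable {K : SimpleGraph V} {u v : V} (h : K.Reachable u v) (huv : u ≠ v) :
    ∃ a, K.Adj u a := by
  obtain ⟨p⟩ := h
  cases p with
  | nil => exact absurd rfl huv
  | cons ha _ => exact ⟨_, ha⟩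

theorem exists_adj_of_mem_nonemptyComponents {C : G.Subgraph} (hC : C ∈ nonemptyComponents H)
    {u : V} (hu : u ∈ C.verts) : ∃ v, C.Adj u v := by
  obtain ⟨⟨e, he⟩, c, hc⟩ := id hC
  induction e with
  | h a b =>
  have hab : C.Adj a b := he
  rcases eq_or_ne u a with rfl | hne
  · exact ⟨b, hab⟩
  · have ha := hab.fst_mem
    rw [hc] at hu ha
    have h1 : H.spanningCoe.connectedComponentMk u = c := hu
    have h2 : H.spanningCoe.connectedComponentMk a = c := ha
    obtain ⟨v, hv⟩ := exists_adj_of_reachable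
      (SimpleGraph.ConnectedComponent.exact (h1.trans h2.symm)) hne
    exact ⟨v, adj_of_mem_nonemptyComponents hC (hc ▸ hu) hv⟩

/-- The union of the trees `M C` over the non-empty components `C` of `H`. -/
def treeUnion (H : G.Subgraph) (M : G.Subgraph → G.Subgraph) : SimpleGraph V where
  Adj u v := ∃ C ∈ nonemptyComponents H, (M C).Adj u v
  symm := ⟨fun _ _ ⟨C, hC, h⟩ => ⟨C, hC, h.symm⟩⟩
  loopless := ⟨fun _ ⟨C, _, h⟩ => (M C).loopless.irrefl _ h⟩

variable {w : Sym2 V → ℝ} {M : G.Subgraph → G.Subgraph}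

theorem IsKruskalTree.verts_eq {C M : G.Subgraph} (h : IsKruskalTree w C M) : M.verts = C.verts := by
  obtain ⟨l, -, -, -, hv, -⟩ := h
  exact hv

theorem treeUnion_adj_iff (hM : ∀ C ∈ nonemptyComponents H, IsKruskalTree w C (M C))
    {C : G.Subgraph} (hC : C ∈ nonemptyComponents H) {u v : V} (hu : u ∈ C.verts) :
    (treeUnion H M).Adj u v ↔ (M C).Adj u v := by
  refine ⟨?_, fun h => ⟨C, hC, h⟩⟩
  rintro ⟨C', hC', h⟩
  have : u ∈ C'.verts := (hM C' hC').verts_eq ▸ h.fst_mem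
  rwa [eq_of_mem_nonemptyComponents hC hC' hu this]

theorem treeUnion_isAcyclic (hM : ∀ C ∈ nonemptyComponents H, IsKruskalTree w C (M C)) :
    (treeUnion H M).IsAcyclic := by
  -- A walk that starts in `C` stays in the tree of `C`, so a cycle would be a cycle of a single
  -- Kruskal tree.
  have key : ∀ C ∈ nonemptyComponents H, ∀ u v (p : (treeUnion H M).Walk u v), u ∈ C.verts →
      ∀ e ∈ p.edges, e ∈ (M C).spanningCoe.edgeSet := by
    intro C hC u v p
    induction p with
    | nil => simp
    | cons h p ih =>
      intro hu e he
      rw [treeUnion_adj_iff hM hC hu] at h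
      rw [SimpleGraph.Walk.edges_cons, List.mem_cons] at he
      rcases he with rfl | he
      · exact h
      · exact ih ((hM C hC).verts_eq ▸ h.snd_mem) e he
  intro u p hp
  cases p with
  | nil => simp at hp
  | cons h p =>
    obtain ⟨C, hC, h'⟩ := id h
    have hu : u ∈ C.verts := (hM C hC).verts_eq ▸ h'.fst_mem
    exact (hM C hC).isAcyclic _ (hp.transfer (key C hC _ _ _ hu))

theorem mem_prune_verts {x : V → ℝ} {M : G.Subgraph} {i : V} :
    i ∈ (prune x M).verts ↔ i ∈ M.verts ∧ ¬ ((M.neighborSet i).ncard = 1 ∧ x i < 1 / 2) := by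
  simp only [prune, SimpleGraph.Subgraph.deleteVerts_verts, Set.mem_sdiff, Set.mem_ofPred_eq]
  tauto

theorem prune_adj {x : V → ℝ} {M : G.Subgraph} {u v : V} :
    (prune x M).Adj u v ↔ M.Adj u v ∧ u ∈ (prune x M).verts ∧ v ∈ (prune x M).verts := by
  refine ⟨fun h => ⟨?_, h.fst_mem, h.snd_mem⟩, fun ⟨h, hu, hv⟩ => ?_⟩
  · rw [prune, SimpleGraph.Subgraph.deleteVerts_adj] at h
    exact h.2.2.2.2
  · rw [prune, SimpleGraph.Subgraph.deleteVerts_adj]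
    exact ⟨hu.1, hu.2, hv.1, hv.2, h⟩

/-- The subgraph returned by the algorithm with trees `M`. -/
def output (x : V → ℝ) (H : G.Subgraph) (M : G.Subgraph → G.Subgraph) : G.Subgraph :=
  keptIsolated x H ⊔ ⨆ C ∈ nonemptyComponents H, prune x (M C)

theorem mem_output_verts {x : V → ℝ} {i : V} : i ∈ (output x H M).verts ↔
    (i ∈ H.verts ∧ (∀ j, ¬ H.Adj i j) ∧ 1 / 2 ≤ x i) ∨
      ∃ C ∈ nonemptyComponents H, i ∈ (prune x (M C)).verts := by
  simp only [output, keptIsolated, SimpleGraph.Subgraph.verts_sup, SimpleGraph.Subgraph.verts_iSup,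
    Set.mem_union, Set.mem_iUnion, exists_prop, Set.mem_ofPred_eq]

theorem output_adj_iff {x : V → ℝ} (hM : ∀ C ∈ nonemptyComponents H, IsKruskalTree w C (M C))
    {u v : V} : (output x H M).Adj u v ↔
      (treeUnion H M).Adj u v ∧ u ∈ (output x H M).verts ∧ v ∈ (output x H M).verts := by
  -- Components are disjoint and a vertex of `C` is not isolated in `H`, so it can enter the output
  -- only through its own pruned tree.
  have hverts : ∀ C ∈ nonemptyComponents H, ∀ i ∈ C.verts, i ∈ (output x H M).verts →
      i ∈ (prune x (M C)).verts := by
    intro C hC i hi h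
    rcases mem_output_verts.1 h with ⟨-, h, -⟩ | ⟨C', hC', h⟩
    · obtain ⟨j, hj⟩ := exists_adj_of_mem_nonemptyComponents hC hi
      obtain ⟨-, c, rfl⟩ := hC
      exact absurd hj.2.2 (h j)
    · have : i ∈ C'.verts := (hM C' hC').verts_eq ▸ (mem_prune_verts.1 h).1
      rwa [eq_of_mem_nonemptyComponents hC hC' hi this]
  have hadj : (output x H M).Adj u v ↔ ∃ C ∈ nonemptyComponents H, (prune x (M C)).Adj u v := by
    simp [output, keptIsolated]
  refine ⟨fun h => ⟨?_, h.fst_mem, h.snd_mem⟩, fun ⟨⟨C, hC, h⟩, hu, hv⟩ => ?_⟩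
  · obtain ⟨C, hC, h⟩ := hadj.1 h
    exact ⟨C, hC, (prune_adj.1 h).1⟩
  · exact hadj.2 ⟨C, hC, prune_adj.2 ⟨h, hverts C hC u ((hM C hC).verts_eq ▸ h.fst_mem) hu,
      hverts C hC v ((hM C hC).verts_eq ▸ h.snd_mem) hv⟩⟩

theorem lt_half_of_notMem_output {x : V → ℝ} (hx : ∀ i ∉ H.verts, x i < 1 / 2)
    (hM : ∀ C ∈ nonemptyComponents H, IsKruskalTree w C (M C)) {i : V}
    (hi : i ∉ (output x H M).verts) : x i < 1 / 2 := by
  by_contra hlt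
  refine hi (mem_output_verts.2 ?_)
  by_cases hadj : ∃ j, H.Adj i j
  · obtain ⟨j, hj⟩ := hadj
    obtain ⟨C, hC, h⟩ := exists_mem_nonemptyComponents hj
    exact Or.inr ⟨C, hC, mem_prune_verts.2 ⟨(hM C hC).verts_eq ▸ h.fst_mem, fun h => hlt h.2⟩⟩
  · push Not at hadj
    exact Or.inl ⟨by_contra fun h => hlt (hx i h), hadj, not_lt.1 hlt⟩

/-- A tree vertex missing from the output was pruned, hence was pendant. -/
theorem eq_of_adj_of_notMem_output {x : V → ℝ}
    (hM : ∀ C ∈ nonemptyComponents H, IsKruskalTree w C (M C)) {i u v : V}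
    (hi : i ∉ (output x H M).verts) (hu : (treeUnion H M).Adj i u)
    (hv : (treeUnion H M).Adj i v) : u = v := by
  obtain ⟨C, hC, hu⟩ := hu
  have hiM := hu.fst_mem
  rw [treeUnion_adj_iff hM hC ((hM C hC).verts_eq ▸ hiM)] at hv
  have h : ((M C).neighborSet i).ncard = 1 := by
    by_contra h
    exact hi (mem_output_verts.2 (Or.inr ⟨C, hC, mem_prune_verts.2 ⟨hiM, fun h' => h h'.1⟩⟩))
  obtain ⟨a, ha⟩ := Set.ncard_eq_one.1 h
  have h1 : u ∈ (M C).neighborSet i := hu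
  have h2 : v ∈ (M C).neighborSet i := hv
  rw [ha, Set.mem_singleton_iff] at h1 h2
  rw [h1, h2]

/-- With `x i < 1/2`, the vertex was not kept as isolated. Its tree is spanning, so its degree there
is positive, and surviving the pruning excludes degree one. -/
theorem exists_two_adj_of_mem_output {x : V → ℝ}
    (hM : ∀ C ∈ nonemptyComponents H, IsKruskalTree w C (M C)) {i : V}
    (hi : i ∈ (output x H M).verts) (hx : x i < 1 / 2) :
    ∃ u v, u ≠ v ∧ (treeUnion H M).Adj u i ∧ (treeUnion H M).Adj v i := by
  rcases mem_output_verts.1 hi with ⟨-, -, h⟩ | ⟨C, hC, h⟩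
  · exact absurd hx h.not_gt
  · obtain ⟨hiM, h⟩ := mem_prune_verts.1 h
    have hiC : i ∈ C.verts := (hM C hC).verts_eq ▸ hiM
    obtain ⟨j, hj⟩ := exists_adj_of_mem_nonemptyComponents hC hiC
    obtain ⟨u, hu⟩ := exists_adj_of_reachable ((hM C hC).reachable hj) (C.adj_sub hj).ne
    have hu : (M C).Adj i u := ((SimpleGraph.fromEdgeSet_adj _).1 hu).1.1
    have : ∃ v, (M C).Adj i v ∧ v ≠ u := by
      by_contra hno
      push Not at hno
      refine h ⟨Set.ncard_eq_one.2 ⟨u, ?_⟩, hx⟩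
      ext v
      exact ⟨fun hv => hno v hv, fun hv => by rwa [Set.mem_singleton_iff.1 hv]⟩
    obtain ⟨v, hv, hvu⟩ := this
    exact ⟨u, v, hvu.symm, ⟨C, hC, hu.symm⟩, ⟨C, hC, hv.symm⟩⟩

variable [Fintype V]

theorem exists_isLPRounding (G : SimpleGraph V) (w : Sym2 V → ℝ) :
    ∃ F : G.Subgraph, IsLPRounding w F := by
  obtain ⟨x, y, h⟩ := exists_isOptimalLP G w
  choose M hM using exists_isKruskalTree (G := G) w
  exact ⟨_, x, y, h, M, fun C _ => hM C, rfl⟩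

-- The layered bound applies with `R` the complement of the output, since the output is the subgraph
-- of the tree union induced on its own vertices. It is a vertex cover because two absent endpoints,
-- both with `x < 1/2`, would violate the cover constraint.
open Classical in
theorem IsLPRounding.isForestCover_and_wi_le
    (hw : ∀ e ∈ G.edgeSet, w e ∈ Set.Icc (0 : ℝ) 1) {F : G.Subgraph} (hF : IsLPRounding w F) :
    IsForestCover F ∧ ∃ x y, IsOptimalLP G w x y ∧ wi w F ≤ 2 * objective G w x y := by
  obtain ⟨x, y, h, M, hM, hF⟩ := hF
  set H := supportGraph h.feasible
  change F = output x H M at hF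
  subst hF
  have hx : ∀ i ∉ H.verts, x i < 1 / 2 := fun i hi => by
    have : x i ≤ 0 := not_lt.1 hi
    linarith
  have hac := treeUnion_isAcyclic hM
  have hTG : treeUnion H M ≤ G := fun u v ⟨C, _, h⟩ => (M C).adj_sub h
  refine ⟨⟨?_, ?_⟩, x, y, h, ?_⟩
  · exact hac.comap (G := (output x H M).coe)
      ⟨Subtype.val, fun {u v} huv => ((output_adj_iff hM).1 huv).1⟩ Subtype.val_injective
  · intro u v huv
    by_contra hno
    push Not at hno
    have h1 := lt_half_of_notMem_output hx hM hno.1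
    have h2 := lt_half_of_notMem_output hx hM hno.2
    linarith [h.feasible.cover u v huv]
  · have hR : ∀ i, i ∈ (Finset.univ.filter fun i => i ∉ (output x H M).verts) ↔
        i ∉ (output x H M).verts := fun i => by simp
    have := h.feasible.card_sub_sum_le hw hTG hac (fun u v huv hy => ?_)
      (R := Finset.univ.filter fun i => i ∉ (output x H M).verts)
      (fun i hi => lt_half_of_notMem_output hx hM ((hR i).1 hi))
      (fun i hi u v => eq_of_adj_of_notMem_output hM ((hR i).1 hi))
      (fun i hi => exists_two_adj_of_mem_output hM (not_not.1 fun hh => hi ((hR i).2 hh)))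
    · rw [wi_eq]
      refine le_trans (le_of_eq ?_) this
      congr 1
      · congr 2
        ext i
        simp
      · refine Finset.sum_congr ?_ fun _ _ => rfl
        ext e
        induction e with
        | h u v =>
        simp only [Set.mem_toFinset, SimpleGraph.Subgraph.mem_edgeSet, Finset.mem_filter,
          SimpleGraph.mem_edgeFinset, SimpleGraph.mem_edgeSet, output_adj_iff hM, Sym2.mem_iff,
          Finset.mem_univ, true_and, not_not, forall_eq_or_imp, forall_eq]
    · obtain ⟨C, hC, hCuv⟩ := exists_mem_nonemptyComponents (H := H) ⟨huv, hy⟩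
      refine ((hM C hC).reachable hCuv).mono (SimpleGraph.fromEdgeSet_mono ?_)
      rintro f ⟨hf, hwf⟩
      refine ⟨?_, hwf⟩
      induction f with
      | h a b => exact ⟨C, hC, hf⟩

end Output

end ForestCover

theorem theorem5 {V : Type*} [Fintype V] (G : SimpleGraph V) (w : Sym2 V → ℝ)
    (hw : ∀ e ∈ G.edgeSet, w e ∈ Set.Icc (0 : ℝ) 1) :
    (∃ OPT : G.Subgraph, ForestCover.IsOptimalForestCover w OPT) ∧
    (∃ APX : G.Subgraph, ForestCover.IsLPRounding w APX) ∧
    ∀ OPT APX : G.Subgraph, ForestCover.IsOptimalForestCover w OPT →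
      ForestCover.IsLPRounding w APX →
      ForestCover.IsForestCover APX ∧
        ForestCover.wi w OPT ≥ 1 / 2 * ForestCover.wi w APX := by
  refine ⟨ForestCover.exists_isOptimalForestCover w, ForestCover.exists_isLPRounding G w, ?_⟩
  intro OPT APX hOPT hAPX
  obtain ⟨hcov, x, y, hxy, hle⟩ := hAPX.isForestCover_and_wi_le hw
  refine ⟨hcov, ?_⟩
  have := hxy.optimal _ _ hOPT.1.isFeasible
  rw [ForestCover.objective_indicator] at this
  linarith
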